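/- A *compact line* is a totally ordered set that is compact in its order topology. Let $K$ be a compact line. $NBV(K)$ denotes the set of right-continuous maps $F:K\to\mathbb R$ of bounded variation; each $F\in NBV(K)$ corresponds to the unique finite regular signed Borel measure $\mu$ on $K$ with $F(t)=\mu([\min K,t])$ for all $t\in K$. A family $(F_i)_{i\in I}$ in $NBV(K)$, with corresponding measures $(\mu_i)_{i\in I}$, is *weak\*-null* if $\big(\int_K f\,d\mu_i\big)_{i\in I}\in c_0(I)$ for every continuous $f:K\to\mathbb R$, where $c_0(I)$ is the set of real families $(x_i)_{i\in I}$ such that $\{i\in I:|x_i|\ge\varepsilon\}$ is finite for every $\varepsilon>0$. A family $(F_i)_{i\in I}$ of real-valued maps is *of type $c_0\ell_1$ over* a set $Q$ if there are real numbers $a_{i,t},b_{i,t}$ ($i\in I$, $t\in Q$) with $F_i(t)=a_{i,t}+b_{i,t}$ for all $i\in I$ and $t\in Q$, with $(a_{i,t})_{i\in I}\in c_0(I)$ for every $t\in Q$, and with $\sup_{i\in I}\sum_{t\in Q}|b_{i,t}|<\infty$. For $H\subseteq K$, let $H^+$ be the set of points $t\in H$ such that either $t=\max H$ or there is $s\in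 H$ with $s>t$ and $]t,s[\,\cap H=\emptyset$. The compact line $K$ is *separably determined* if, for every set $I$, every weak\*-null family $(F_i)_{i\in I}$ in $NBV(K)$ and every $Q\subseteq K$, the following holds: if the set $$\{t\in Q\cap(H\setminus H^+):(F_i(t))_{i\in I}\notin c_0(I)\}$$ is countable for every closed separable subset $H$ of $K$, then $(F_i)_{i\in I}$ is of type $c_0\ell_1$ over $Q$. **Theorem.** (1) Let $\varphi:K\to L$ be a continuous increasing (i.e. order-preserving, not necessarily strictly) surjection between compact lines. If $L$ is separably determined and $\varphi^{-1}(t)$, with the induced order, is separably determined for every $t\in L$, then $K$ is separably determined. (2) If $K$ and $L$ are separably determined compact lines, then the cartesian product $K\times L$ endowed with the lexicographic order is a separably determined compact line. -/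

import Mathlib

universe u

open Filter Topology MeasureTheory

/-- A compact line: a totally ordered set with its order topology, which is compact. -/
structure IsCompactLine (K : Type u) [LinearOrder K] [TopologicalSpace K] : Prop where
  orderTopology : OrderTopology K
  compactSpace : CompactSpace K

/-- The right isolated points of a subset `H` of a totally ordered set, with respect to the
induced order on `H`: the maximum of `H` (if any) and the points of `H` that have an immediate
successor in `H`. -/
def rightIsolatedPoints {K : Type u} [LinearOrder K] (H : Set K) : Set K :=
  {t | t ∈ H ∧ (IsGreatest H t ∨ ∃ s ∈ H, t < s ∧ Set.Ioo t s ∩ H = ∅)}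

/-- `NBV(K)`: right-continuous real-valued maps of bounded variation. -/
def IsNBV {K : Type u} [LinearOrder K] [TopologicalSpace K] (F : K → ℝ) : Prop :=
  BoundedVariationOn F Set.univ ∧ ∀ t, ContinuousWithinAt F (Set.Ici t) t

/-- `(x i)` belongs to `c₀(I)`. -/
def IsC0 {I : Type u} (x : I → ℝ) : Prop :=
  Tendsto x cofinite (𝓝 0)

/-- The regular finite signed Borel measure `μ` is the one that corresponds to the map `F`,
that is, `F t = μ [min K, t]` for all `t`. -/
def IsRepresentedBy {K : Type u} [LinearOrder K] [TopologicalSpace K] [MeasurableSpace K]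
    (F : K → ℝ) (μ : SignedMeasure K) : Prop :=
  μ.variation.Regular ∧ ∀ t, F t = μ (Set.Iic t)

/-- A weak*-null family in `NBV(K)`: the corresponding family `(μ i)` of regular finite signed Borel
measures, viewed in the dual space of `C(K)`, converges to zero in the weak*-topology, meaning that
`(∫ f dμ i)` belongs to `c₀(I)` for every continuous `f`. -/
def IsWeakStarNull {K : Type u} [LinearOrder K] [TopologicalSpace K] {I : Type u}
    (F : I → K → ℝ) : Prop :=
  letI : MeasurableSpace K := borel K
  (∀ i, IsNBV (F i)) ∧
    ∃ μ : I → SignedMeasure K, (∀ i, IsRepresentedBy (F i) (μ i)) ∧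
      ∀ f : C(K, ℝ), IsC0 fun i => ∫ᵛ t, f t ∂•(μ i)

/-- The family `(F i)` is of type `c₀ℓ₁` over the set `Q`. -/
def IsTypeC0L1 {K I : Type u} (F : I → K → ℝ) (Q : Set K) : Prop :=
  ∃ a b : I → Q → ℝ,
    (∀ i (t : Q), F i t = a i t + b i t) ∧
    (∀ t, IsC0 fun i => a i t) ∧
    ∃ C : ℝ, ∀ i, Summable (fun t => |b i t|) ∧ ∑' t, |b i t| ≤ C

/-- `K` is a separably determined compact line. -/
structure IsSeparablyDetermined (K : Type u) [LinearOrder K] [TopologicalSpace K] : Prop where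
  isCompactLine : IsCompactLine K
  isTypeC0L1 : ∀ (I : Type u) (F : I → K → ℝ), IsWeakStarNull F → ∀ Q : Set K,
    (∀ H : Set K, IsClosed H → TopologicalSpace.SeparableSpace H →
      {t | t ∈ Q ∩ (H \ rightIsolatedPoints H) ∧ ¬ IsC0 fun i => F i t}.Countable) →
    IsTypeC0L1 F Q

/-! ### Signed measures and their total variation -/

section SignedMeasures

variable {X : Type*} [MeasurableSpace X]

/-! Let `α t` and `β t` be the extremes of the fibre of `φ` over `t`. Pushing the measures forward
along `φ` turns `F i` into `F i ∘ β`, so the hypothesis on `L` decomposes the family at the fibre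
maxima. Clamping `K` onto a fibre and pushing forward decomposes it at the other points of that
fibre (`HasC0L1Bound.of_ordConnected`). The obstacle is that the `ℓ₁` bounds so obtained depend on
the fibre and need not add up. `HasC0L1Bound.uniformize` replaces them by five times the variation
of `μ i` on `]α t, β t]`. These intervals are disjoint, and the total variations are bounded by
Banach–Steinhaus, so `HasC0L1Bound.glue` applies.

Uniformization rests on `finite_setOf_lt_abs_measure_Iic`. For each `i` a finite set `T i` carries
nearly all of `b i`. Off `T i`, values comparable to `b i` are cheap; on `T i`, so are values
dominated by the mass up to the next point. The remaining bad points form a point-countable family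
of finite sets; `exists_rank` ranks them so that an initial segment can be kept within budget while
the discarded values stay pointwise in `c₀`.

For the lexicographic product, the first projection is continuous and its fibres are copies of `L`.
-/

instance isFiniteMeasure_variation (μ : SignedMeasure X) : IsFiniteMeasure μ.variation := by
  rw [← SignedMeasure.totalVariation_eq_variation, SignedMeasure.totalVariation]
  infer_instance

theorem abs_integral_le_integral_abs (μ : SignedMeasure X) (f : X → ℝ) :
    |∫ᵛ x, f x ∂•μ| ≤ ∫ x, |f x| ∂μ.variation := by
  have h := VectorMeasure.norm_integral_le_integral_norm (f := f) (μ := μ)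
    (B := ContinuousLinearMap.lsmul ℝ ℝ)
  refine h.trans ?_
  have h0 : 0 ≤ ∫ x, |f x| ∂μ.variation := integral_nonneg fun _ => abs_nonneg _
  simpa only [one_mul, Real.norm_eq_abs] using mul_le_mul_of_nonneg_right
    (ContinuousLinearMap.opNorm_lsmul_le (𝕜 := ℝ) (E := ℝ) (R := ℝ)) h0

theorem integral_indicator_one (μ : SignedMeasure X) {s : Set X} (hs : MeasurableSet s) :
    ∫ᵛ x, s.indicator (fun _ => (1 : ℝ)) x ∂•μ = μ s := by
  simp [VectorMeasure.integral_indicator_const _ hs]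

/-- The sign function of a Hahn decomposition. -/
theorem exists_sign_function (μ : SignedMeasure X) :
    ∃ g : X → ℝ, Measurable g ∧ (∀ x, |g x| ≤ 1) ∧
      ∫ᵛ x, g x ∂•μ = μ.variation.real Set.univ := by
  obtain ⟨P, hP, h1, h2, h3, h4⟩ := μ.toJordanDecomposition_spec
  have hi : ∀ s : Set X, MeasurableSet s →
      μ.Integrable (s.indicator fun _ => (1 : ℝ)) := fun s hs =>
    (integrable_const (1 : ℝ)).indicator hs
  refine ⟨fun x => P.indicator (fun _ => (1 : ℝ)) x - Pᶜ.indicator (fun _ => (1 : ℝ)) x,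
    (measurable_const.indicator hP).sub (measurable_const.indicator hP.compl), fun x => ?_, ?_⟩
  · by_cases hx : x ∈ P <;> simp [hx]
  · rw [VectorMeasure.integral_fun_sub (hi P hP) (hi _ hP.compl), integral_indicator_one μ hP,
      integral_indicator_one μ hP.compl, ← SignedMeasure.totalVariation_eq_variation,
      SignedMeasure.totalVariation, measureReal_add_apply, h3, h4,
      SignedMeasure.toMeasureOfZeroLE_real_apply _ _ _ MeasurableSet.univ,
      SignedMeasure.toMeasureOfLEZero_real_apply _ _ _ MeasurableSet.univ]
    simp [sub_eq_add_neg]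

variable [TopologicalSpace X] [BorelSpace X] [CompactSpace X]

theorem ContinuousMap.integrable_variation (μ : SignedMeasure X) (f : C(X, ℝ)) :
    μ.Integrable f := by
  refine (integrable_const ‖f‖).mono' f.continuous.measurable.aestronglyMeasurable ?_
  exact Eventually.of_forall fun x => f.norm_coe_le_norm x

/-- The norm of the functional induced by a regular signed measure on a compact space is at least
its total variation. -/
theorem variation_univ_le_of_forall_integral_le [T2Space X] (μ : SignedMeasure X)
    (hμ : μ.variation.Regular) {C : ℝ}
    (hC : ∀ f : C(X, ℝ), (∀ x, |f x| ≤ 1) → |∫ᵛ x, f x ∂•μ| ≤ C) :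
    μ.variation.real Set.univ ≤ C := by
  obtain ⟨g, hgm, hg1, hgi⟩ := exists_sign_function μ
  have hgint : Integrable g μ.variation :=
    (integrable_const (1 : ℝ)).mono' hgm.aestronglyMeasurable (Eventually.of_forall hg1)
  refine le_of_forall_pos_le_add fun ε hε => ?_
  obtain ⟨h, -, hle, hcont, hint⟩ := hgint.exists_hasCompactSupport_integral_sub_le hε
  -- Truncation to `[-1, 1]` is 1-Lipschitz and fixes `g`, so it does not worsen the approximation.
  let f : C(X, ℝ) := ⟨fun x => max (-1) (min 1 (h x)), by fun_prop⟩
  have hf1 : ∀ x, |f x| ≤ 1 := fun x => by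
    simp only [f, ContinuousMap.coe_mk, abs_le]
    exact ⟨le_max_left _ _, max_le (by norm_num) (min_le_left _ _)⟩
  have hfint := ContinuousMap.integrable_variation μ f
  have hfg : ∀ x, |g x - f x| ≤ ‖g x - h x‖ := fun x => by
    have hx := abs_le.1 (hg1 x)
    have e : g x = max (-1) (min 1 (g x)) := by rw [min_eq_right hx.2, max_eq_right hx.1]
    rw [Real.norm_eq_abs]
    conv_lhs => rw [e]
    refine (abs_max_sub_max_le_max _ _ _ _).trans ?_
    simp only [sub_self, abs_zero]
    refine max_le (abs_nonneg _) ((abs_min_sub_min_le_max _ _ _ _).trans ?_)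
    simp
  have h1 : |∫ᵛ x, g x ∂•μ - ∫ᵛ x, f x ∂•μ| ≤ ε := by
    rw [← VectorMeasure.integral_fun_sub hgint hfint]
    refine (abs_integral_le_integral_abs _ _).trans (le_trans ?_ hle)
    exact integral_mono (hgint.sub hfint).abs (hgint.sub hint).norm hfg
  rw [← hgi]
  have h2 := hC f hf1
  have h3 := (abs_le.1 h1).2
  have h4 := (abs_le.1 h2).2
  linarith

end SignedMeasures

theorem isC0_iff {I : Type u} {x : I → ℝ} :
    IsC0 x ↔ ∀ ε > 0, {i | ε ≤ |x i|}.Finite := by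
  rw [IsC0, Metric.tendsto_nhds]
  simp [Filter.eventually_cofinite, not_lt]

theorem IsC0.exists_bound {I : Type u} {x : I → ℝ} (hx : IsC0 x) : ∃ C, ∀ i, |x i| ≤ C := by
  have h : Tendsto (fun i => |x i|) cofinite (𝓝 0) := by simpa using! hx.abs
  obtain ⟨C, hC⟩ := h.bddAbove_range_of_cofinite
  exact ⟨C, fun i => hC ⟨i, rfl⟩⟩

/-! ### Weak*-null families of measures -/

section WeakStarNull

variable {X : Type u} [TopologicalSpace X] [MeasurableSpace X] [BorelSpace X] [CompactSpace X]

/-- Integration with respect to a signed measure, as a functional on the continuous functions. -/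
noncomputable def integralCLM (μ : SignedMeasure X) : C(X, ℝ) →L[ℝ] ℝ :=
  LinearMap.mkContinuous
    { toFun := fun f => ∫ᵛ x, f x ∂•μ
      map_add' := fun f g => by
        simpa using VectorMeasure.integral_fun_add (B := ContinuousLinearMap.lsmul ℝ ℝ)
          (ContinuousMap.integrable_variation μ f) (ContinuousMap.integrable_variation μ g)
      map_smul' := fun c f => by
        simpa using VectorMeasure.integral_fun_smul (μ := μ) (B := ContinuousLinearMap.lsmul ℝ ℝ)
          c f }
    (μ.variation.real Set.univ) fun f => by
      refine (abs_integral_le_integral_abs μ f).trans ?_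
      refine (integral_mono (ContinuousMap.integrable_variation μ f).abs
        (integrable_const ‖f‖) fun x => f.norm_coe_le_norm x).trans ?_
      simp

/-- A weak*-null family of regular signed measures has bounded total variations. -/
theorem exists_variation_univ_le [T2Space X] {I : Type u} (μ : I → SignedMeasure X)
    (hμ : ∀ i, (μ i).variation.Regular)
    (h0 : ∀ f : C(X, ℝ), IsC0 fun i => ∫ᵛ t, f t ∂•(μ i)) :
    ∃ C, ∀ i, (μ i).variation.real Set.univ ≤ C := by
  obtain ⟨C, hC⟩ := banach_steinhaus (g := fun i => integralCLM (μ i)) fun f => (h0 f).exists_bound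
  refine ⟨C, fun i => variation_univ_le_of_forall_integral_le _ (hμ i) fun f hf => ?_⟩
  have h1 : ‖f‖ ≤ 1 := (ContinuousMap.norm_le _ zero_le_one).2 hf
  have h2 : 0 ≤ C := (norm_nonneg _).trans (hC i)
  exact ((integralCLM (μ i)).le_of_opNorm_le (hC i) f).trans (mul_le_of_le_one_right h2 h1)

/-- Outside finitely many indices, `|μ i [min, q]|` is controlled by the mass of an
arbitrarily short interval to the right of `q`. -/
theorem finite_setOf_lt_abs_measure_Iic [LinearOrder X] [OrderTopology X] {I : Type u}
    (μ : I → SignedMeasure X) (h0 : ∀ f : C(X, ℝ), IsC0 fun i => ∫ᵛ t, f t ∂•(μ i))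
    {q q' : X} (hq : q < q') {ε : ℝ} (hε : 0 < ε) :
    {i | (μ i).variation.real (Set.Ioc q q') + ε ≤ |μ i (Set.Iic q)|}.Finite := by
  obtain ⟨f, hf0, hf1, hf⟩ := exists_continuous_zero_one_of_isClosed (isClosed_Ici (a := q'))
    (isClosed_Iic (a := q)) (Set.disjoint_left.2 fun x h1 h2 => (hq.trans_le h1).not_ge h2)
  refine (isC0_iff.1 (h0 f) ε hε).subset fun i hi => ?_
  rw [Set.mem_ofPred_eq] at hi ⊢
  have hfi := ContinuousMap.integrable_variation (μ i) f
  have hgi : (μ i).Integrable ((Set.Iic q).indicator fun _ => (1 : ℝ)) :=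
    (integrable_const (1 : ℝ)).indicator measurableSet_Iic
  -- The Urysohn function `f` equals the indicator of `]-∞, q]` off `]q, q']` and differs from it by
  -- at most 1 there.
  have h1 : |μ i (Set.Iic q) - ∫ᵛ t, f t ∂•(μ i)| ≤ (μ i).variation.real (Set.Ioc q q') := by
    rw [← integral_indicator_one (μ i) measurableSet_Iic,
      ← VectorMeasure.integral_fun_sub hgi hfi]
    refine (abs_integral_le_integral_abs _ _).trans ?_
    refine (integral_mono (hgi.sub hfi).abs
      ((integrable_const (1 : ℝ)).indicator (measurableSet_Ioc (a := q) (b := q')))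
      fun x => ?_).trans ?_
    · change |(Set.Iic q).indicator (fun _ => (1 : ℝ)) x - f x| ≤
        (Set.Ioc q q').indicator (fun _ => (1 : ℝ)) x
      rcases le_or_gt x q with hx | hx
      · have : f x = 1 := hf1 hx
        simp [Set.indicator, hx, this, hx.not_gt]
      · rcases le_or_gt x q' with hx' | hx'
        · simp [Set.indicator, hx, hx', hx.not_ge, abs_of_nonneg (hf x).1, (hf x).2]
        · have : f x = 0 := hf0 hx'.le
          simp [Set.indicator, hx.not_ge, this, hx'.not_ge]
    · simp [integral_indicator_const _ (measurableSet_Ioc (a := q) (b := q'))]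
  have h2 := abs_sub_abs_le_abs_sub (μ i (Set.Iic q)) (∫ᵛ t, f t ∂•(μ i))
  linarith

end WeakStarNull

/-! ### Pushforward of measures and of weak*-null families -/

/-- The image of a regular signed measure under a continuous map is regular. -/
theorem regular_variation_map {X Y : Type*} [TopologicalSpace X] [MeasurableSpace X] [BorelSpace X]
    [TopologicalSpace Y] [MeasurableSpace Y] [BorelSpace Y]
    [T2Space Y] (μ : SignedMeasure X) (hμ : μ.variation.Regular) {ψ : X → Y} (hψ : Continuous ψ) :
    (μ.map ψ).variation.Regular := by
  have : (μ.variation.map ψ).InnerRegularCompactLTTop :=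
    Measure.InnerRegularCompactLTTop.map_of_continuous hψ
  have : (μ.map ψ).variation.InnerRegularCompactLTTop := by
    refine ⟨fun s hs r hr => ?_⟩
    -- `C` is chosen for the pushforward of the variation, which dominates the variation of the
    -- pushforward.
    obtain ⟨C, hCs, hC, hlt⟩ := hs.1.exists_isCompact_sdiff_lt
      (measure_ne_top (μ.variation.map ψ) s) (tsub_pos_of_lt hr).ne'
    refine ⟨C, hCs, hC, ?_⟩
    have h1 := (VectorMeasure.variation_map_le (μ := μ) (φ := ψ) (s \ C)).trans_lt hlt
    have h2 : (μ.map ψ).variation s ≤ (μ.map ψ).variation C + (μ.map ψ).variation (s \ C) := by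
      rw [← measure_union Set.disjoint_sdiff_right (hs.1.diff hC.measurableSet),
        Set.union_sdiff_cancel hCs]
    by_contra! hle
    have h3 := h2.trans (add_le_add hle le_rfl)
    exact absurd h1 (not_lt.2 (tsub_le_iff_left.2 h3))
  infer_instance

section Pushforward

variable {K L : Type u} [LinearOrder K] [TopologicalSpace K] [LinearOrder L] [TopologicalSpace L]

/-- The pushforward of a weak*-null family under a continuous increasing surjection. -/
theorem IsWeakStarNull.pushforward (hK : IsCompactLine K) (hL : IsCompactLine L) {I : Type u}
    {F : I → K → ℝ} (hF : IsWeakStarNull F) {ψ : K → L} (hψ : Continuous ψ) (hmono : Monotone ψ)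
    {β : L → K} (hβ : ∀ t, IsGreatest (ψ ⁻¹' {t}) (β t)) :
    IsWeakStarNull fun i t => F i (β t) := by
  have := hK.orderTopology
  have := hK.compactSpace
  have := hL.orderTopology
  have := hL.compactSpace
  have hψβ : ∀ t, ψ (β t) = t := fun t => (hβ t).1
  -- `β` is the upper adjoint of `ψ`. This gives both its right continuity and `ψ ⁻¹' Iic t = Iic (β
  -- t)`.
  have hle : ∀ x t, x ≤ β t ↔ ψ x ≤ t := fun x t =>
    ⟨fun h => (hmono h).trans_eq (hψβ t), fun h => by
      by_contra! hlt
      exact hlt.not_ge ((hβ t).2 (le_antisymm h ((hψβ t).symm.trans_le (hmono hlt.le))))⟩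
  have hβm : Monotone β := fun s t hst => (hle _ _).2 ((hψβ s).trans_le hst)
  let _ : MeasurableSpace K := borel K
  let _ : MeasurableSpace L := borel L
  have : BorelSpace K := ⟨rfl⟩
  have : BorelSpace L := ⟨rfl⟩
  obtain ⟨hbv, μ, hμ, h0⟩ := hF
  refine ⟨fun i => ⟨?_, fun t => ?_⟩, fun i => (μ i).map ψ, fun i => ⟨?_, fun t => ?_⟩, fun f => ?_⟩
  · have h1 : eVariationOn (F i ∘ β) Set.univ ≤ eVariationOn (F i) Set.univ :=
      eVariationOn.comp_le_of_monotoneOn _ β (hβm.monotoneOn _) (Set.mapsTo_univ _ _)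
    exact ne_top_of_le_ne_top (hbv i).1 h1
  · refine ((hbv i).2 (β t)).comp (t := Set.Ici (β t)) ?_ fun s hs => hβm hs
    have h1 : Tendsto β (𝓝[≥] t) (𝓝 (β t)) := by
      refine tendsto_order.2 ⟨fun a ha => ?_, fun b hb => ?_⟩
      · filter_upwards [self_mem_nhdsWithin] with s hs using ha.trans_le (hβm hs)
      · have : t < ψ b := by
          by_contra! h
          exact hb.not_ge ((hle _ _).2 h)
        filter_upwards [mem_nhdsWithin_of_mem_nhds (Iio_mem_nhds this)] with s hs
        by_contra! h
        exact (hs : s < ψ b).not_ge ((hle _ _).1 h)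
    exact h1
  · exact regular_variation_map (μ i) (hμ i).1 hψ
  · have h1 : ψ ⁻¹' Set.Iic t = Set.Iic (β t) := by
      ext x
      exact (hle x t).symm
    rw [VectorMeasure.map_apply _ hψ.measurable measurableSet_Iic, h1]
    exact (hμ i).2 _
  · have h1 := h0 (f.comp ⟨ψ, hψ⟩)
    refine h1.congr fun i => ?_
    rw [VectorMeasure.integral_map hψ.measurable f.continuous.measurable.aestronglyMeasurable]
    · rfl
    · exact ContinuousMap.integrable_variation (μ i) (f.comp ⟨ψ, hψ⟩)

end Pushforward

/-! ### Decompositions with an explicit `ℓ₁` bound -/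

/-- `F` is, over `Q`, the sum of a family that is pointwise in `c₀` and of a family `b` such that
the `ℓ₁`-norm of `b i` is at most `c i`. -/
def HasC0L1Bound {X : Type*} {I : Type u} (F : I → X → ℝ) (Q : Set X) (c : I → ℝ) : Prop :=
  ∃ b : I → X → ℝ, (∀ t ∈ Q, IsC0 fun i => F i t - b i t) ∧
    ∀ i, ∀ T : Finset X, (∀ t ∈ T, t ∈ Q) → ∑ t ∈ T, |b i t| ≤ c i

theorem isTypeC0L1_iff {K I : Type u} {F : I → K → ℝ} {Q : Set K} :
    IsTypeC0L1 F Q ↔ ∃ C, HasC0L1Bound F Q fun _ => C := by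
  classical
  constructor
  · rintro ⟨a, b, hF, ha, C, hC⟩
    refine ⟨C, fun i t => if h : t ∈ Q then b i ⟨t, h⟩ else 0, fun t ht => ?_, fun i T hT => ?_⟩
    · have : (fun i => F i t - if h : t ∈ Q then b i ⟨t, h⟩ else 0) = fun i => a i ⟨t, ht⟩ := by
        funext i
        simp [ht, hF i ⟨t, ht⟩]
      rw [this]
      exact ha ⟨t, ht⟩
    · refine le_trans ?_ (hC i).2
      refine le_trans (le_of_eq ?_)
        ((hC i).1.sum_le_tsum (T.subtype (· ∈ Q)) fun _ _ => abs_nonneg _)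
      rw [← Finset.sum_subtype_of_mem (fun t => |if h : t ∈ Q then b i ⟨t, h⟩ else 0|) hT]
      exact Finset.sum_congr rfl fun t _ => by simp [t.2]
  · rintro ⟨C, b, hb, hC⟩
    have hs : ∀ i (T : Finset Q), ∑ t ∈ T, |b i t| ≤ C := fun i T => by
      have h := hC i (T.map (Function.Embedding.subtype _)) fun t ht => by
        obtain ⟨s, -, rfl⟩ := Finset.mem_map.1 ht
        exact s.2
      simpa using h
    refine ⟨fun i t => F i t - b i t, fun i t => b i t, fun i t => by ring, fun t => hb t t.2, C,
      fun i => ?_⟩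
    have := summable_of_sum_le (fun _ => abs_nonneg _) (hs i)
    exact ⟨this, this.tsum_le_of_sum_le (hs i)⟩

/-! ### Successors in a finite set -/

section NextIn

variable {X : Type*} [LinearOrder X]

/-- The least element of `T` that is greater than `a`, or `β` if there is none below `β`. -/
def nextIn (T : Finset X) (β a : X) : X :=
  (insert β (T.filter (a < ·))).min' (Finset.insert_nonempty _ _)

theorem nextIn_le_right (T : Finset X) (β a : X) : nextIn T β a ≤ β :=
  Finset.min'_le _ _ (Finset.mem_insert_self _ _)

theorem nextIn_le_of_mem {T : Finset X} {β a s : X} (hs : s ∈ T) (h : a < s) : nextIn T β a ≤ s :=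
  Finset.min'_le _ _ (Finset.mem_insert_of_mem (Finset.mem_filter.2 ⟨hs, h⟩))

theorem lt_nextIn {T : Finset X} {β a : X} (h : a < β) : a < nextIn T β a := by
  refine (Finset.lt_min'_iff _ _).2 fun s hs => ?_
  rcases Finset.mem_insert.1 hs with rfl | hs
  · exact h
  · exact (Finset.mem_filter.1 hs).2

theorem nextIn_insert_of_le {T : Finset X} {β a s : X} (h : a ≤ s) :
    nextIn (insert a T) β s = nextIn T β s := by
  unfold nextIn
  congr 2
  rw [Finset.filter_insert, if_neg h.not_gt]

/-- The intervals from each point of `T` to its successor are consecutive, so superadditivity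
telescopes. -/
theorem sum_nextIn_le {w : X → X → ℝ} (hw0 : ∀ a b, 0 ≤ w a b)
    (hadd : ∀ a b c, a ≤ b → b ≤ c → w a b + w b c ≤ w a c) {β : X} (T : Finset X) :
    ∀ α, (∀ s ∈ T, α ≤ s ∧ s < β) → ∑ s ∈ T, w s (nextIn T β s) ≤ w α β := by
  induction T using Finset.induction_on_min with
  | empty => simpa using fun α => hw0 α β
  | insert a T ha ih =>
    intro α hα
    have haT : a ∉ T := fun h => (ha a h).false
    have haβ := hα a (Finset.mem_insert_self _ _)
    rw [Finset.sum_insert haT, nextIn_insert_of_le le_rfl,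
      Finset.sum_congr rfl fun s hs => by rw [nextIn_insert_of_le (ha s hs).le]]
    have h1 := ih (nextIn T β a) fun s hs =>
      ⟨nextIn_le_of_mem hs (ha s hs), (hα s (Finset.mem_insert_of_mem hs)).2⟩
    have h2 := hadd a _ _ (lt_nextIn (T := T) haβ.2).le (nextIn_le_right T β a)
    have h3 := hadd α a β haβ.1 haβ.2.le
    have h4 := hw0 α a
    linarith

end NextIn

/-! ### Countability and ranks -/

section Countability

/-- If the relation `R` is locally countable, so are its connected components. -/
theorem countable_reflTransGen {X : Type*} {R : X → X → Prop} (hR : ∀ x, {y | R x y}.Countable)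
    (x : X) : {y | Relation.ReflTransGen R x y}.Countable := by
  let c : ℕ → Set X := fun n => Nat.rec {x} (fun _ s => ⋃ y ∈ s, {z | R y z}) n
  have hc : ∀ n, (c n).Countable := fun n => by
    induction n with
    | zero => exact Set.countable_singleton x
    | succ n ih => exact ih.biUnion fun y _ => hR y
  refine (Set.countable_iUnion hc).mono fun y (hy : Relation.ReflTransGen R x y) => ?_
  induction hy with
  | refl => exact Set.mem_iUnion.2 ⟨0, rfl⟩
  | tail _ h ih =>
    obtain ⟨n, hn⟩ := Set.mem_iUnion.1 ih
    exact Set.mem_iUnion.2 ⟨n + 1, Set.mem_biUnion hn h⟩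

/-- For a point-countable family of finite sets there is an integer-valued rank with respect to
which every point shares a set with only finitely many points of bounded rank. -/
theorem exists_rank {X I : Type*} (B : I → Finset X) (hB : ∀ s, {i | s ∈ B i}.Countable) :
    ∃ rank : X → ℕ, ∀ s n, {s' | (∃ i, s ∈ B i ∧ s' ∈ B i) ∧ rank s' ≤ n}.Finite := by
  let R : X → X → Prop := fun s s' => ∃ i, s ∈ B i ∧ s' ∈ B i
  have hR : ∀ s, {s' | R s s'}.Countable := fun s => by
    refine ((hB s).biUnion fun i _ => (B i).countable_toSet).mono ?_
    rintro s' ⟨i, h1, h2⟩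
    exact Set.mem_biUnion h1 h2
  have hsymm : Std.Symm R := ⟨fun s s' ⟨i, h1, h2⟩ => ⟨i, h2, h1⟩⟩
  let S : Setoid X := ⟨Relation.ReflTransGen R, fun _ => .refl,
    fun h => Relation.ReflTransGen.stdSymm.symm _ _ h, fun h h' => h.trans h'⟩
  choose f hf using fun x => Set.countable_iff_exists_injOn.1 (countable_reflTransGen hR x)
  -- The rank is the position in an enumeration of the connected component; going through `out`
  -- makes all points of a component use the same enumeration.
  refine ⟨fun s => f (Quotient.mk S s).out s, fun s n => ?_⟩
  refine Set.Finite.of_injOn (f := f (Quotient.mk S s).out) (t := Set.Iic n) ?_ ?_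
    (Set.finite_Iic n)
  · rintro s' ⟨h, hn⟩
    have : Quotient.mk S s' = Quotient.mk S s :=
      Quotient.sound (s := S) (Relation.ReflTransGen.single (hsymm.symm _ _ h))
    simpa only [this, Set.mem_Iic] using! hn
  · refine (hf _).mono ?_
    rintro s' ⟨h, -⟩
    exact (Quotient.exact (Quotient.out_eq (Quotient.mk S s)) : S _ _).trans
      (Relation.ReflTransGen.single h)

/-- If `B` is infinite, it contains an injective sequence `S`. A point with value below every `f (S
n)` would have an infinite upper section, so the finite upper sections at the `S n` cover `B`. -/
theorem countable_of_finite_setOf_le {I X : Type*} [LinearOrder X] {B : Set I} (f : I → X)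
    (hf : ∀ j ∈ B, {i ∈ B | f j ≤ f i}.Finite) : B.Countable := by
  rcases B.finite_or_infinite with hB | hB
  · exact hB.countable
  have hS := (Set.Infinite.natEmbedding B hB).injective
  set S : ℕ → I := fun n => (Set.Infinite.natEmbedding B hB n : I)
  have hSinj : Function.Injective S := fun m n h => hS (Subtype.ext h)
  have hSB : ∀ n, S n ∈ B := fun n => (Set.Infinite.natEmbedding B hB n).2
  refine (Set.countable_iUnion fun n => (hf (S n) (hSB n)).countable).mono fun i hi => ?_
  by_contra hcon
  have h1 : ∀ n, f i ≤ f (S n) := fun n => by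
    by_contra! hlt
    exact hcon (Set.mem_iUnion.2 ⟨n, hi, hlt.le⟩)
  exact Set.infinite_range_of_injective hSinj
    ((hf i hi).subset (Set.range_subset_iff.2 fun n => ⟨hSB n, h1 n⟩))

end Countability

/-! ### Making the `ℓ₁` bounds proportional to the mass of the interval -/

section Uniformize

variable {X : Type*} [LinearOrder X] {I : Type u} {F : I → X → ℝ} {w : I → X → X → ℝ}

theorem finite_setOf_le_sum_abs (hw0 : ∀ i a b, 0 ≤ w i a b)
    (hadd : ∀ i a b c, a ≤ b → b ≤ c → w i a b + w i b c ≤ w i a c) {α β : X} {T : Finset X}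
    (hT : ∀ s ∈ T, α ≤ s ∧ s < β)
    (hF : ∀ q ∈ T, ∀ q', q < q' → ∀ ε > 0, {i | w i q q' + ε ≤ |F i q|}.Finite)
    {ε : ℝ} (hε : 0 < ε) : {i | w i α β + ε ≤ ∑ s ∈ T, |F i s|}.Finite := by
  -- Each point gets the share `ε / (card + 1)`: this makes sense for empty `T` and keeps the total
  -- strictly below `ε`.
  have hn : (0 : ℝ) < T.card + 1 := by positivity
  refine (T.finite_toSet.biUnion fun s hs => hF s hs (nextIn T β s) (lt_nextIn (hT s hs).2)
    (ε / (T.card + 1)) (by positivity)).subset fun i hi => ?_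
  by_contra hcon
  simp only [Set.mem_iUnion, not_exists, Set.mem_ofPred_eq, not_le] at hcon hi
  have h1 : ∑ s ∈ T, |F i s| ≤ ∑ s ∈ T, (w i s (nextIn T β s) + ε / (T.card + 1)) :=
    Finset.sum_le_sum fun s hs => (hcon s hs).le
  rw [Finset.sum_add_distrib, Finset.sum_const, nsmul_eq_mul] at h1
  have h2 := sum_nextIn_le (hw0 i) (hadd i) T α hT
  have h3 : (T.card : ℝ) * (ε / (T.card + 1)) < ε := by
    rw [mul_div_assoc', div_lt_iff₀ hn]
    nlinarith
  linarith

/-- Restrict to `|F i q| > 1 / (n + 1)`. If `nxt j ≤ nxt i`, then `w i q (nxt j)` is less than half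
of `|F i q|`, which leaves the other half for a fixed `ε`. So `hF` at `nxt j` makes every upper
section with respect to `nxt` finite. -/
theorem countable_setOf_two_mul_lt_abs (hw0 : ∀ i a b, 0 ≤ w i a b)
    (hadd : ∀ i a b c, a ≤ b → b ≤ c → w i a b + w i b c ≤ w i a c) {q : X}
    (hF : ∀ q', q < q' → ∀ ε > 0, {i | w i q q' + ε ≤ |F i q|}.Finite)
    {nxt : I → X} (hnxt : ∀ i, q < nxt i) :
    {i | 2 * w i q (nxt i) < |F i q|}.Countable := by
  have hsub : {i | 2 * w i q (nxt i) < |F i q|} ⊆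
      ⋃ n : ℕ, {i | 2 * w i q (nxt i) < |F i q| ∧ 1 / ((n : ℝ) + 1) < |F i q|} := fun i hi => by
    have h0 : 0 < |F i q| :=
      lt_of_le_of_lt (mul_nonneg zero_le_two (hw0 i q (nxt i))) hi
    obtain ⟨n, hn⟩ := exists_nat_one_div_lt h0
    exact Set.mem_iUnion.2 ⟨n, hi, hn⟩
  refine (Set.countable_iUnion fun n => ?_).mono hsub
  refine countable_of_finite_setOf_le nxt fun j _ => ?_
  refine (hF (nxt j) (hnxt j) (1 / ((n : ℝ) + 1) / 2) (by positivity)).subset ?_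
  rintro i ⟨⟨h1, h2⟩, h3⟩
  have h4 := hadd i q (nxt j) (nxt i) (hnxt j).le h3
  have h5 := hw0 i (nxt j) (nxt i)
  rw [Set.mem_ofPred_eq]
  linarith

/-- Any `T` whose sum is within `ε` of the supremum of the finite sums works. -/
theorem exists_finset_sum_disjoint_le {Q : Set X} {b : X → ℝ} {C : ℝ}
    (hb : ∀ T : Finset X, (∀ t ∈ T, t ∈ Q) → ∑ t ∈ T, |b t| ≤ C) {ε : ℝ} (hε : 0 < ε) :
    ∃ T : Finset X, (∀ t ∈ T, t ∈ Q) ∧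
      ∀ S : Finset X, (∀ t ∈ S, t ∈ Q) → Disjoint S T → ∑ t ∈ S, |b t| ≤ ε := by
  let A : Set ℝ := {x | ∃ T : Finset X, (∀ t ∈ T, t ∈ Q) ∧ ∑ t ∈ T, |b t| = x}
  have hne : A.Nonempty := ⟨0, ∅, by simp⟩
  have hbdd : BddAbove A := ⟨C, by rintro x ⟨T, hT, rfl⟩; exact hb T hT⟩
  obtain ⟨x, ⟨T, hT, rfl⟩, hlt⟩ := exists_lt_of_lt_csSup hne (sub_lt_self (sSup A) hε)
  refine ⟨T, hT, fun S hS hd => ?_⟩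
  have h1 : ∑ t ∈ S ∪ T, |b t| ≤ sSup A := le_csSup hbdd ⟨S ∪ T, fun t ht => by
    rcases Finset.mem_union.1 ht with h | h
    exacts [hS t h, hT t h], rfl⟩
  rw [Finset.sum_union hd] at h1
  linarith

/-- A decomposition with uniformly bounded `ℓ₁`-norms can be replaced by one whose `ℓ₁`-norms are
controlled by the masses `w i α β`. -/
theorem HasC0L1Bound.uniformize (hw0 : ∀ i a b, 0 ≤ w i a b)
    (hadd : ∀ i a b c, a ≤ b → b ≤ c → w i a b + w i b c ≤ w i a c) {α β : X} {Q : Set X}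
    (hQ : ∀ s ∈ Q, α ≤ s ∧ s < β)
    (hF : ∀ q ∈ Q, ∀ q', q < q' → ∀ ε > 0, {i | w i q q' + ε ≤ |F i q|}.Finite)
    {C : ℝ} (h : HasC0L1Bound F Q fun _ => C) : HasC0L1Bound F Q fun i => 5 * w i α β := by
  classical
  obtain ⟨b, hb, hbC⟩ := h
  have hT : ∀ i, ∃ T : Finset X, (∀ t ∈ T, t ∈ Q) ∧ (0 < w i α β →
      ∀ S : Finset X, (∀ t ∈ S, t ∈ Q) → Disjoint S T → ∑ t ∈ S, |b i t| ≤ w i α β / 2) := by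
    intro i
    by_cases hV : 0 < w i α β
    · obtain ⟨T, h1, h2⟩ := exists_finset_sum_disjoint_le (hbC i) (half_pos hV)
      exact ⟨T, h1, fun _ => h2⟩
    · exact ⟨∅, by simp, fun h => absurd h hV⟩
  choose T hTQ hTsum using hT
  let B : I → Finset X := fun i => (T i).filter fun s => 2 * w i s (nextIn (T i) β s) < |F i s|
  have hBQ : ∀ i, ∀ s ∈ B i, s ∈ Q := fun i s hs => hTQ i s (Finset.mem_filter.1 hs).1
  have hBc : ∀ s, {i | s ∈ B i}.Countable := fun s => by
    by_cases hs : s ∈ Q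
    · exact (countable_setOf_two_mul_lt_abs hw0 hadd (hF s hs)
        fun i => lt_nextIn (T := T i) (hQ s hs).2).mono fun i hi => (Finset.mem_filter.1 hi).2
    · exact Set.countable_empty.mono fun i hi => hs (hBQ i s hi)
  obtain ⟨rank, hrank⟩ := exists_rank B hBc
  -- The values retained in the new `b` cost at most `w`, `2w` and `2w` for `Tail`, `Good` and
  -- `Kept`, with `w = w i α β`; hence the factor 5.
  let Tail : I → X → Prop := fun i s => s ∉ T i ∧ 0 < w i α β ∧ |F i s| ≤ 2 * |b i s|
  let Good : I → X → Prop := fun i s => s ∈ T i ∧ |F i s| ≤ 2 * w i s (nextIn (T i) β s)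
  let Kept : I → X → Prop := fun i s => s ∈ B i ∧
    ∑ s' ∈ (B i).filter (rank · ≤ rank s), |F i s'| ≤ 2 * w i α β
  refine ⟨fun i s => if Tail i s ∨ Good i s ∨ Kept i s then F i s else 0, fun s hs => ?_,
    fun i S hS => ?_⟩
  · rw [isC0_iff]
    intro ε hε
    -- This finite set depends on `s` only, yet contains every bad point of rank at most `rank s` in
    -- any `B i` that contains `s`.
    have hfin := hrank s (rank s)
    have hN := finite_setOf_le_sum_abs (F := F) hw0 hadd (T := hfin.toFinset)
      (fun t ht => by
        obtain ⟨⟨i, -, hi⟩, -⟩ := hfin.mem_toFinset.1 ht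
        exact hQ t (hBQ i t hi))
      (fun t ht => by
        obtain ⟨⟨i, -, hi⟩, -⟩ := hfin.mem_toFinset.1 ht
        exact hF t (hBQ i t hi)) (half_pos hε)
    refine (((isC0_iff.1 (hb s hs) (ε / 2) (half_pos hε)).union
      (hF s hs β (hQ s hs).2 ε hε)).union hN).subset fun i hi => ?_
    rw [Set.mem_ofPred_eq] at hi
    beta_reduce at hi
    by_cases hcase : Tail i s ∨ Good i s ∨ Kept i s
    · rw [if_pos hcase, sub_self, abs_zero] at hi
      exact absurd hi hε.not_ge
    rw [if_neg hcase, sub_zero] at hi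
    simp only [not_or] at hcase
    obtain ⟨hTail, hGood, hKept⟩ := hcase
    rcases lt_or_ge (2 * |b i s|) |F i s| with hlt | hge
    · refine Or.inl (Or.inl ?_)
      have := abs_sub_abs_le_abs_sub (F i s) (b i s)
      rw [Set.mem_ofPred_eq]
      linarith
    by_cases hsT : s ∈ T i
    · have hsB : s ∈ B i := Finset.mem_filter.2 ⟨hsT, not_le.1 fun h => hGood ⟨hsT, h⟩⟩
      have h1 : 2 * w i α β < ∑ s' ∈ (B i).filter (rank · ≤ rank s), |F i s'| :=
        not_le.1 fun h => hKept ⟨hsB, h⟩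
      have h2 : ∑ s' ∈ (B i).filter (rank · ≤ rank s), |F i s'| ≤
          ∑ s' ∈ hfin.toFinset, |F i s'| :=
        Finset.sum_le_sum_of_subset_of_nonneg (fun t ht => by
          obtain ⟨h3, h4⟩ := Finset.mem_filter.1 ht
          exact hfin.mem_toFinset.2 ⟨⟨i, hsB, h3⟩, h4⟩) fun _ _ _ => abs_nonneg _
      have h3 : |F i s| ≤ ∑ s' ∈ hfin.toFinset, |F i s'| :=
        Finset.single_le_sum (f := fun t => |F i t|) (fun _ _ => abs_nonneg _)
          (hfin.mem_toFinset.2 ⟨⟨i, hsB, hsB⟩, le_rfl⟩)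
      -- The sum exceeds `2w` and is at least `ε`; averaging the two bounds gives `w + ε / 2`.
      refine Or.inr ?_
      rw [Set.mem_ofPred_eq]
      linarith
    · refine Or.inl (Or.inr ?_)
      -- No mass is left to the right of `s` either, so `hF` with `q' = β` allows only finitely many
      -- such `i`.
      have h1 : w i α β ≤ 0 := not_lt.1 fun h => hTail ⟨hsT, h, hge⟩
      have h2 := hadd i α s β (hQ s hs).1 (hQ s hs).2.le
      have h3 := hw0 i α s
      rw [Set.mem_ofPred_eq]
      linarith
  · have hpt : ∀ s ∈ S, |if Tail i s ∨ Good i s ∨ Kept i s then F i s else 0| ≤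
        (if Tail i s then |F i s| else 0) + ((if Good i s then |F i s| else 0) +
          if Kept i s then |F i s| else 0) := fun s _ => by
      have := abs_nonneg (F i s)
      by_cases h1 : Tail i s <;> by_cases h2 : Good i s <;> by_cases h3 : Kept i s <;>
        simp [h1, h2, h3]
    refine (Finset.sum_le_sum hpt).trans ?_
    rw [Finset.sum_add_distrib, Finset.sum_add_distrib, ← Finset.sum_filter, ← Finset.sum_filter,
      ← Finset.sum_filter]
    have hV := hw0 i α β
    have hTailSum : ∑ s ∈ S.filter (Tail i), |F i s| ≤ w i α β := by
      by_cases hV0 : 0 < w i α β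
      · have h1 := hTsum i hV0 (S.filter (Tail i)) (fun t ht => hS t (Finset.mem_filter.1 ht).1)
          (Finset.disjoint_left.2 fun t ht => (Finset.mem_filter.1 ht).2.1)
        have h2 : ∑ s ∈ S.filter (Tail i), |F i s| ≤ ∑ s ∈ S.filter (Tail i), 2 * |b i s| :=
          Finset.sum_le_sum fun t ht => (Finset.mem_filter.1 ht).2.2.2
        rw [← Finset.mul_sum] at h2
        linarith
      · rw [Finset.filter_false_of_mem fun t _ ht => hV0 ht.2.1]
        simpa using hV
    have hGoodSum : ∑ s ∈ S.filter (Good i), |F i s| ≤ 2 * w i α β := by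
      calc ∑ s ∈ S.filter (Good i), |F i s|
          ≤ ∑ s ∈ S.filter (Good i), 2 * w i s (nextIn (T i) β s) :=
            Finset.sum_le_sum fun t ht => (Finset.mem_filter.1 ht).2.2
        _ ≤ ∑ s ∈ T i, 2 * w i s (nextIn (T i) β s) :=
            Finset.sum_le_sum_of_subset_of_nonneg (fun t ht => (Finset.mem_filter.1 ht).2.1)
              fun t _ _ => mul_nonneg zero_le_two (hw0 _ _ _)
        _ ≤ 2 * w i α β := by
            rw [← Finset.mul_sum]
            exact mul_le_mul_of_nonneg_left
              (sum_nextIn_le (hw0 i) (hadd i) (T i) α fun s hs => hQ s (hTQ i s hs)) zero_le_two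
    have hKeptSum : ∑ s ∈ S.filter (Kept i), |F i s| ≤ 2 * w i α β := by
      rcases (S.filter (Kept i)).eq_empty_or_nonempty with he | hne
      · rw [he]
        simpa using hV
      · obtain ⟨m, hm, hmax⟩ := (S.filter (Kept i)).exists_max_image rank hne
        refine le_trans ?_ (Finset.mem_filter.1 hm).2.2
        exact Finset.sum_le_sum_of_subset_of_nonneg (fun t ht => Finset.mem_filter.2
          ⟨(Finset.mem_filter.1 ht).2.1, hmax t ht⟩) fun _ _ _ => abs_nonneg _
    linarith

end Uniformize

/-! ### Transfer from subsets and gluing over fibres -/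

theorem HasC0L1Bound.of_subtype {X : Type*} {I : Type u} {A Q : Set X} {F : I → X → ℝ} {c : I → ℝ}
    {G : I → A → ℝ} (hG : ∀ i (s : A), (s : X) ∈ Q → G i s = F i s) (hQ : Q ⊆ A)
    (h : HasC0L1Bound G {s | (s : X) ∈ Q} c) : HasC0L1Bound F Q c := by
  classical
  obtain ⟨b, hb, hc⟩ := h
  refine ⟨fun i s => if h : s ∈ A then b i ⟨s, h⟩ else 0, fun t ht => ?_, fun i T hT => ?_⟩
  · have h1 := hb ⟨t, hQ ht⟩ ht
    simpa only [hG _ ⟨t, hQ ht⟩ ht, dif_pos (hQ ht)] using h1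
  · have h1 := hc i (T.subtype (· ∈ A)) fun t ht => hT _ (Finset.mem_subtype.1 ht)
    refine le_trans (le_of_eq ?_) h1
    rw [← Finset.sum_subtype_of_mem (fun t => |if h : t ∈ A then b i ⟨t, h⟩ else 0|)
      fun t ht => hQ (hT t ht)]
    exact Finset.sum_congr rfl fun t _ => by simp [t.2]

/-- Each point is either the chosen point `β (φ s)` of its fibre, paid for by `C`, or another point,
paid for by its own fibre; the fibre costs sum to at most `d i`. -/
theorem HasC0L1Bound.glue {K L : Type*} {I : Type u}
    {F : I → K → ℝ} {Q : Set K} {φ : K → L} {β : L → K}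
    {C : ℝ} {c : I → L → ℝ} {d : I → ℝ}
    (hc : ∀ i (T : Finset L), ∑ t ∈ T, c i t ≤ d i)
    (hL : HasC0L1Bound (fun i t => F i (β t)) {t | β t ∈ Q} fun _ => C)
    (hfib : ∀ t, HasC0L1Bound F {s ∈ Q | φ s = t ∧ s ≠ β t} fun i => c i t) :
    HasC0L1Bound F Q fun i => C + d i := by
  classical
  obtain ⟨bL, hbL, hCL⟩ := hL
  choose b hb hbc using hfib
  refine ⟨fun i s => if s = β (φ s) then bL i (φ s) else b (φ s) i s, fun s hs => ?_,
    fun i S hS => ?_⟩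
  · by_cases h : s = β (φ s)
    · simp only [if_pos h]
      have h1 := hbL (φ s) (show β (φ s) ∈ Q from h ▸ hs)
      simpa only [← h] using h1
    · simp only [if_neg h]
      exact hb (φ s) s ⟨hs, rfl, h⟩
  · rw [← Finset.sum_filter_add_sum_filter_not S fun s => s = β (φ s)]
    refine add_le_add ?_ ?_
    · have hinj : Set.InjOn φ (S.filter fun s => s = β (φ s)) := fun x hx y hy hxy => by
        rw [(Finset.mem_filter.1 hx).2, (Finset.mem_filter.1 hy).2, hxy]
      have h1 := hCL i ((S.filter fun s => s = β (φ s)).image φ) fun t ht => by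
        obtain ⟨s, hs, rfl⟩ := Finset.mem_image.1 ht
        obtain ⟨h2, h3⟩ := Finset.mem_filter.1 hs
        exact (show β (φ s) ∈ Q from h3 ▸ hS s h2)
      rw [Finset.sum_image hinj] at h1
      refine le_trans (le_of_eq (Finset.sum_congr rfl fun s hs => ?_)) h1
      simp only [if_pos (Finset.mem_filter.1 hs).2]
    · rw [← Finset.sum_fiberwise_of_maps_to (t := S.image φ) (g := φ) fun s hs =>
        Finset.mem_image_of_mem _ (Finset.mem_filter.1 hs).1]
      refine le_trans (Finset.sum_le_sum fun t _ => ?_) (hc i (S.image φ))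
      refine le_trans (le_of_eq (Finset.sum_congr rfl fun s hs => ?_))
        (hbc t i (((S.filter fun s => ¬s = β (φ s))).filter fun s => φ s = t) fun s hs => ?_)
      · obtain ⟨h1, h2⟩ := Finset.mem_filter.1 hs
        subst h2
        simp only [if_neg (Finset.mem_filter.1 h1).2]
      · obtain ⟨h1, h2⟩ := Finset.mem_filter.1 hs
        obtain ⟨h3, h4⟩ := Finset.mem_filter.1 h1
        exact ⟨hS s h3, h2, h2 ▸ h4⟩

theorem separableSpace_closure {X : Type*} [TopologicalSpace X] {s : Set X} (hs : s.Countable) :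
    TopologicalSpace.SeparableSpace (closure s) := by
  have := hs.to_subtype
  exact ((denseRange_inclusion_iff (subset_closure (s := s))).2 le_rfl).separableSpace
    (continuous_inclusion _)

/-! ### Right isolated points -/

section RightIsolated

variable {L : Type u} [LinearOrder L]

theorem exists_between_of_notMem_rightIsolatedPoints {H : Set L} {t : L} (ht : t ∈ H)
    (h : t ∉ rightIsolatedPoints H) : (∃ s ∈ H, t < s) ∧ ∀ s ∈ H, t < s → ∃ r ∈ H, t < r ∧ r < s := by
  have h1 : ¬(IsGreatest H t ∨ ∃ s ∈ H, t < s ∧ Set.Ioo t s ∩ H = ∅) := fun h' => h ⟨ht, h'⟩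
  simp only [not_or, not_exists, not_and] at h1
  refine ⟨?_, fun s hs hts => ?_⟩
  · by_contra! hcon
    exact h1.1 ⟨ht, hcon⟩
  · obtain ⟨r, hr, hrH⟩ := Set.nonempty_iff_ne_empty.2 (h1.2 s hs hts)
    exact ⟨r, hrH, hr.1, hr.2⟩

theorem notMem_rightIsolatedPoints_of_exists_between {H : Set L} {t : L} (h1 : ∃ s ∈ H, t < s)
    (h2 : ∀ s ∈ H, t < s → ∃ r ∈ H, t < r ∧ r < s) : t ∉ rightIsolatedPoints H := by
  rintro ⟨-, hg | ⟨s, hs, hts, he⟩⟩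
  · obtain ⟨s, hs, hts⟩ := h1
    exact hts.not_ge (hg.2 hs)
  · obtain ⟨r, hr, h3, h4⟩ := h2 s hs hts
    exact Set.notMem_empty r (he ▸ ⟨⟨h3, h4⟩, hr⟩)

/-- A point of a closed set `H` which is not right isolated is a limit from the right of every
dense subset of `H`. -/
theorem exists_dense_between [TopologicalSpace L] [OrderTopology L] [CompactSpace L] {H : Set L}
    (hH : IsClosed H) {D : Set H} (hD : Dense D) {t : L} (ht : t ∈ H)
    (h : t ∉ rightIsolatedPoints H) {u : L} (hu : t < u) : ∃ d ∈ D, t < (d : L) ∧ (d : L) < u := by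
  obtain ⟨⟨s, hs, hts⟩, hbet⟩ := exists_between_of_notMem_rightIsolatedPoints ht h
  have h1 : ∃ r ∈ H, t < r ∧ r < u := by
    by_contra! hcon
    obtain ⟨m, hm⟩ := (hH.inter isClosed_Ici).isCompact.exists_isLeast
      (⟨s, hs, hcon s hs hts⟩ : (H ∩ Set.Ici u).Nonempty)
    obtain ⟨r, hr, h2, h3⟩ := hbet m hm.1.1 (hu.trans_le hm.1.2)
    exact h3.not_ge (hm.2 ⟨hr, hcon r hr h2⟩)
  obtain ⟨r, hr, h2, h3⟩ := h1
  obtain ⟨q, hq, h4, h5⟩ := hbet r hr h2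
  obtain ⟨d, hd, hdD⟩ := hD.inter_open_nonempty ((↑) ⁻¹' Set.Ioo t r)
    (isOpen_Ioo.preimage continuous_subtype_val) ⟨⟨q, hq⟩, h4, h5⟩
  exact ⟨d, hdD, hd.1, hd.2.trans h3⟩

end RightIsolated

/-! ### Continuous increasing surjections -/

section Fibers

variable {K L : Type u} [LinearOrder K] [TopologicalSpace K] [LinearOrder L] [TopologicalSpace L]

/-- The hypothesis of separable determinacy: the family is pointwise in `c₀` at all but countably
many points of `Q` that lie in, and are not right isolated in, a given closed separable set. -/
def CountablyFailsC0 {I : Type u} (F : I → K → ℝ) (Q : Set K) : Prop :=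
  ∀ H : Set K, IsClosed H → TopologicalSpace.SeparableSpace H →
    {t | t ∈ Q ∩ (H \ rightIsolatedPoints H) ∧ ¬ IsC0 fun i => F i t}.Countable

/-- `β` need not be continuous, so `H` is replaced by the closure of `β '' D` with `D` countable and
dense in `H`. If `t` is not right isolated in `H`, points of `D` approach it from the right, and
their images approach `β t` from the right because `β` is an upper adjoint. -/
theorem CountablyFailsC0.comp_greatest [OrderTopology K] [OrderTopology L] [CompactSpace L]
    {I : Type u} {F : I → K → ℝ} {Q : Set K} (h : CountablyFailsC0 F Q) {φ : K → L}
    (hmono : Monotone φ) {β : L → K} (hβ : ∀ t, IsGreatest (φ ⁻¹' {t}) (β t)) :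
    CountablyFailsC0 (fun i t => F i (β t)) {t | β t ∈ Q} := by
  intro H hH hsep
  obtain ⟨D, hDc, hD⟩ := TopologicalSpace.exists_countable_dense H
  have hφβ : ∀ t, φ (β t) = t := fun t => (hβ t).1
  have hinj : Function.Injective β := fun s t hst => by rw [← hφβ s, hst, hφβ]
  have hlt : ∀ {t x}, β t < x → t < φ x := fun {t x} hx => by
    by_contra! hle
    exact hx.not_ge ((hβ t).2 (le_antisymm hle ((hφβ t).symm.trans_le (hmono hx.le))))
  have hlt' : ∀ {t x}, t < φ x → β t < x := fun {t x} hx => by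
    by_contra! hle
    exact hx.not_ge ((hmono hle).trans_eq (hφβ t))
  have hc : ((fun d : H => β d) '' D).Countable := hDc.image _
  refine ((h (closure ((fun d : H => β d) '' D)) isClosed_closure
    (separableSpace_closure hc)).preimage hinj).mono ?_
  rintro t ⟨⟨htQ, htH, htr⟩, hnc⟩
  have hbet : ∀ x, β t < x → ∃ d ∈ D, β t < β d ∧ β d < x := fun x hx => by
    obtain ⟨d, hd, h1, h2⟩ := exists_dense_between hH hD htH htr (hlt hx)
    exact ⟨d, hd, hlt' ((hφβ d).symm ▸ h1), hlt' h2⟩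
  obtain ⟨s, hs, hts⟩ := (exists_between_of_notMem_rightIsolatedPoints htH htr).1
  have hts' : β t < β s := hlt' ((hφβ s).symm ▸ hts)
  have hsub : ∀ d ∈ D, β d ∈ closure ((fun d : H => β d) '' D) := fun d hd =>
    subset_closure ⟨d, hd, rfl⟩
  refine ⟨⟨htQ, ?_, ?_⟩, hnc⟩
  · have hglb : IsGLB {x | ∃ d ∈ D, β t < β d ∧ β d = x} (β t) := by
      refine ⟨?_, fun c hc => ?_⟩
      · rintro x ⟨d, -, h1, rfl⟩
        exact h1.le
      · by_contra! hcon
        obtain ⟨d, hd, h1, h2⟩ := hbet c hcon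
        exact h2.not_ge (hc ⟨d, hd, h1, rfl⟩)
    obtain ⟨d, hd, h1, -⟩ := hbet _ hts'
    refine closure_mono ?_ (hglb.mem_closure ⟨β d, d, hd, h1, rfl⟩)
    rintro x ⟨d, hd, -, rfl⟩
    exact ⟨d, hd, rfl⟩
  · refine notMem_rightIsolatedPoints_of_exists_between ?_ fun x _ hx => ?_
    · obtain ⟨d, hd, h1, -⟩ := hbet _ hts'
      exact ⟨β d, hsub d hd, h1⟩
    · obtain ⟨d, hd, h1, h2⟩ := hbet x hx
      exact ⟨β d, hsub d hd, h1, h2⟩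

/-- A closed separable subset of `A` remains so in `K`, and being right isolated depends only on the
induced order. -/
theorem CountablyFailsC0.subtype {I : Type u} {F : I → K → ℝ} {Q A : Set K}
    (h : CountablyFailsC0 F Q) (hA : IsClosed A) {G : I → A → ℝ} {Q' : Set A}
    (hQ' : ∀ s ∈ Q', (s : K) ∈ Q ∧ ∀ i, G i s = F i s) : CountablyFailsC0 G Q' := by
  intro H hH hsep
  have hsep' : TopologicalSpace.SeparableSpace ((↑) '' H : Set K) :=
    (Set.imageFactorization_surjective (f := ((↑) : A → K)) (s := H)).denseRange.separableSpace
      ((continuous_subtype_val.comp continuous_subtype_val).subtype_mk _)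
  refine ((h _ (hA.isClosedMap_subtype_val _ hH) hsep').preimage Subtype.val_injective).mono ?_
  rintro t ⟨⟨htQ, htH, htr⟩, hnc⟩
  obtain ⟨⟨s, hs, hts⟩, hbet⟩ := exists_between_of_notMem_rightIsolatedPoints htH htr
  refine ⟨⟨(hQ' t htQ).1, ⟨t, htH, rfl⟩,
    notMem_rightIsolatedPoints_of_exists_between ⟨s, ⟨s, hs, rfl⟩, hts⟩ ?_⟩, ?_⟩
  · rintro _ ⟨x, hx, rfl⟩ htx
    obtain ⟨r, hr, h1, h2⟩ := hbet x hx htx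
    exact ⟨r, ⟨r, hr, rfl⟩, h1, h2⟩
  · simpa only [(hQ' t htQ).2] using hnc

/-- Over the points of a fibre `[α, β]` other than its maximum, the family is of type `c₀ℓ₁`. -/
theorem HasC0L1Bound.of_ordConnected (hK : IsCompactLine K) {I : Type u} {F : I → K → ℝ}
    (hF : IsWeakStarNull F) {Q : Set K} (hQ : CountablyFailsC0 F Q) {A : Set K}
    (hconv : A.OrdConnected) {α β : K} (hα : IsLeast A α) (hβ : IsGreatest A β)
    (hA : IsSeparablyDetermined A) : ∃ C, HasC0L1Bound F {s ∈ Q | s ∈ A ∧ s ≠ β} fun _ => C := by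
  classical
  have := hK.orderTopology
  have := hK.compactSpace
  have hAI : A = Set.Icc α β := Set.Subset.antisymm (fun x hx => ⟨hα.2 hx, hβ.2 hx⟩)
    (hconv.out hα.1 hβ.1)
  have hclosed : IsClosed A := hAI ▸ isClosed_Icc
  obtain ⟨M, hM⟩ := isCompact_univ.exists_isGreatest (⟨α, trivial⟩ : (Set.univ : Set K).Nonempty)
  have hmem : ∀ x, max α (min x β) ∈ A := fun x => by
    rw [hAI]
    exact ⟨le_max_left _ _, max_le (hα.2 hβ.1) (min_le_right _ _)⟩
  let ψ : K → A := fun x => ⟨max α (min x β), hmem x⟩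
  have hψc : Continuous ψ := by fun_prop
  have hψm : Monotone ψ := fun x y hxy =>
    Subtype.mk_le_mk.2 (max_le_max le_rfl (min_le_min hxy le_rfl))
  have hψA : ∀ s : A, ψ s = s := fun s => Subtype.ext (by
    simp only [ψ]
    rw [min_eq_left (hβ.2 s.2), max_eq_right (hα.2 s.2)])
  -- Clamping sends everything above `β` to `β`, so the fibre over `β` has maximum `M`. The
  -- pushforward therefore agrees with `F` except perhaps at `β`, which is why `β` is excluded.
  let γ : A → K := fun s => if (s : K) = β then M else s
  have hγ : ∀ s, IsGreatest (ψ ⁻¹' {s}) (γ s) := fun s => by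
    by_cases hs : (s : K) = β
    · simp only [γ, if_pos hs]
      refine ⟨Subtype.ext ?_, fun x _ => hM.2 trivial⟩
      simp only [ψ]
      rw [min_eq_right (hM.2 trivial), max_eq_right (hα.2 hβ.1), hs]
    · simp only [γ, if_neg hs]
      refine ⟨hψA s, fun x hx => ?_⟩
      have hx' : max α (min x β) = s := congrArg Subtype.val hx
      have hlt : (s : K) < β := lt_of_le_of_ne (hβ.2 s.2) hs
      have h1 : min x β ≤ s := hx' ▸ le_max_right _ _
      rcases min_le_iff.1 h1 with h | h
      · exact h
      · exact absurd h hlt.not_ge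
  have hnull := hF.pushforward hK hA.isCompactLine hψc hψm hγ
  have hval : ∀ i (s : A), (s : K) ≠ β → F i (γ s) = F i s := fun i s hs => by
    simp only [γ, if_neg hs]
  obtain ⟨C, hC⟩ := isTypeC0L1_iff.1 (hA.isTypeC0L1 I _ hnull
    {s | (s : K) ∈ {s ∈ Q | s ∈ A ∧ s ≠ β}}
    (hQ.subtype hclosed fun s hs => ⟨hs.1, fun i => hval i s hs.2.2⟩))
  exact ⟨C, hC.of_subtype (fun i s hs => hval i s hs.2.2) fun s hs => hs.2.1⟩

/-- Separable determinacy is inherited from the fibres and the image of a continuous increasing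
surjection. -/
theorem IsSeparablyDetermined.of_fibers (hK : IsCompactLine K) {φ : K → L} (hφ : Continuous φ)
    (hmono : Monotone φ) (hsurj : Function.Surjective φ) (hL : IsSeparablyDetermined L)
    (hfib : ∀ t : L, IsSeparablyDetermined (φ ⁻¹' {t})) : IsSeparablyDetermined K := by
  refine ⟨hK, fun I F hF Q hQ => ?_⟩
  have hQ : CountablyFailsC0 F Q := hQ
  have := hK.orderTopology
  have := hK.compactSpace
  have := hL.isCompactLine.orderTopology
  have := hL.isCompactLine.compactSpace
  have hcl : ∀ t, IsCompact (φ ⁻¹' {t}) := fun t => (isClosed_singleton.preimage hφ).isCompact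
  choose α hα using fun t => (hcl t).exists_isLeast (hsurj t)
  choose β hβ using fun t => (hcl t).exists_isGreatest (hsurj t)
  obtain ⟨CL, hCL⟩ := isTypeC0L1_iff.1 (hL.isTypeC0L1 I _
    (hF.pushforward hK hL.isCompactLine hφ hmono hβ) _ (hQ.comp_greatest hmono hβ))
  choose C hC using fun t => HasC0L1Bound.of_ordConnected hK hF hQ
    (Set.ordConnected_singleton.preimage_mono hmono) (hα t) (hβ t) (hfib t)
  let _ : MeasurableSpace K := borel K
  have : BorelSpace K := ⟨rfl⟩
  obtain ⟨-, μ, hμ, h0⟩ := hF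
  obtain ⟨M, hM⟩ := exists_variation_univ_le μ (fun i => (hμ i).1) h0
  let w : I → K → K → ℝ := fun i a b => (μ i).variation.real (Set.Ioc a b)
  have hunif : ∀ t, HasC0L1Bound F {s ∈ Q | φ s = t ∧ s ≠ β t} fun i => 5 * w i (α t) (β t) := by
    intro t
    refine HasC0L1Bound.uniformize (w := w) (fun i a b => measureReal_nonneg)
      (fun i a b c hab hbc => ?_) (fun s hs => ?_) (fun q _ q' hq ε hε => ?_) (hC t)
    · simp only [w]
      rw [← measureReal_union (Set.Ioc_disjoint_Ioc_of_le le_rfl) measurableSet_Ioc,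
        Set.Ioc_union_Ioc_eq_Ioc hab hbc]
    · exact ⟨(hα t).2 hs.2.1, lt_of_le_of_ne ((hβ t).2 hs.2.1) hs.2.2⟩
    · simpa only [w, (hμ _).2] using finite_setOf_lt_abs_measure_Iic μ h0 hq hε
  have hsum : ∀ i (T : Finset L), ∑ t ∈ T, 5 * w i (α t) (β t) ≤ 5 * M := fun i T => by
    rw [← Finset.mul_sum]
    refine mul_le_mul_of_nonneg_left (le_trans ?_ (hM i)) (by norm_num)
    simp only [w]
    rw [← measureReal_biUnion_finset (fun s _ t _ hst => ?_) fun _ _ => measurableSet_Ioc]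
    · exact measureReal_mono (Set.subset_univ _)
    -- A point of `]α t, β t]` lies in the fibre over `t`, by monotonicity.
    · refine Set.disjoint_left.2 fun x hx hy => hst ?_
      have h1 : ∀ r, x ∈ Set.Ioc (α r) (β r) → φ x = r := fun r hr =>
        le_antisymm ((hmono hr.2).trans_eq (hβ r).1) (((hα r).1).symm.trans_le (hmono hr.1.le))
      exact (h1 s hx).symm.trans (h1 t hy)
  exact isTypeC0L1_iff.2 ⟨_, HasC0L1Bound.glue (d := fun _ => 5 * M) hsum hCL hunif⟩

end Fibers

/-! ### Order isomorphisms and the empty line -/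

section OrderIso

variable {K L : Type u} [LinearOrder K] [TopologicalSpace K] [LinearOrder L] [TopologicalSpace L]

/-- The fibres of `e.symm` are singletons, so gluing involves only their maxima and the fibre costs
are zero. -/
theorem IsSeparablyDetermined.of_orderIso (hL : IsSeparablyDetermined L) (hK : IsCompactLine K)
    (e : L ≃o K) : IsSeparablyDetermined K := by
  refine ⟨hK, fun I F hF Q hQ => ?_⟩
  have hQ : CountablyFailsC0 F Q := hQ
  have := hK.orderTopology
  have := hL.isCompactLine.orderTopology
  have := hL.isCompactLine.compactSpace
  have he : ∀ t, IsGreatest (e.symm ⁻¹' {t}) (e t) := fun t =>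
    ⟨e.symm_apply_apply t, fun x (hx : e.symm x = t) => by rw [← hx, e.apply_symm_apply]⟩
  obtain ⟨C, hC⟩ := isTypeC0L1_iff.1 (hL.isTypeC0L1 I _
    (hF.pushforward hK hL.isCompactLine e.symm.continuous e.symm.monotone he) _
    (hQ.comp_greatest e.symm.monotone he))
  refine isTypeC0L1_iff.2 ⟨C + 0, HasC0L1Bound.glue (φ := e.symm) (c := fun _ _ => 0)
    (d := fun _ => 0) (by simp) hC fun t => ?_⟩
  have hempty : ∀ s, s ∉ {s ∈ Q | e.symm s = t ∧ s ≠ e t} := fun s hs =>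
    hs.2.2 (by rw [← hs.2.1, e.apply_symm_apply])
  exact ⟨fun _ _ => 0, fun s hs => absurd hs (hempty s), fun i T _ => by simp⟩

theorem IsSeparablyDetermined.of_isEmpty [IsEmpty K] (hK : IsCompactLine K) :
    IsSeparablyDetermined K :=
  ⟨hK, fun _ _ _ _ _ => isTypeC0L1_iff.2
    ⟨0, fun _ _ => 0, fun t => isEmptyElim t, fun _ _ _ => by simp⟩⟩

end OrderIso

/-! ### Lexicographic products -/

section Lex

/-- An ultrafilter converges to the supremum of the points `x` whose upper ray `Ici x` belongs to
it. -/
theorem compactSpace_of_exists_isLUB {X : Type*} [LinearOrder X] [TopologicalSpace X]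
    [OrderTopology X] (h : ∀ s : Set X, ∃ a, IsLUB s a) : CompactSpace X := by
  refine ⟨isCompact_iff_ultrafilter_le_nhds.2 fun f _ => ?_⟩
  obtain ⟨a, ha⟩ := h {x | Set.Ici x ∈ f}
  refine ⟨a, trivial, tendsto_id'.1 (tendsto_order.2 ⟨fun b hb => ?_, fun b hb => ?_⟩)⟩
  · obtain ⟨x, hx, hbx⟩ := (lt_isLUB_iff ha).1 hb
    exact mem_of_superset hx fun y hy => hbx.trans_le hy
  · have h1 : Set.Ici b ∉ f := fun hmem => hb.not_ge (ha.1 hmem)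
    exact mem_of_superset (Ultrafilter.compl_mem_iff_notMem.2 h1) fun y hy => not_le.1 hy

theorem exists_isLUB_of_compactSpace {X : Type*} [LinearOrder X] [TopologicalSpace X]
    [OrderTopology X] [CompactSpace X] [Nonempty X] (s : Set X) : ∃ a, IsLUB s a := by
  obtain ⟨m, hm⟩ := (isCompact_univ (X := X)).exists_isLeast Set.univ_nonempty
  have h0 : IsLUB ∅ m := isLUB_empty_iff.2 fun b => hm.2 trivial
  rcases s.eq_empty_or_nonempty with rfl | hs
  · exact ⟨m, h0⟩
  · obtain ⟨a, -, ha⟩ := (isClosed_closure (s := s)).isCompact.exists_isLUB hs.closure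
    exact ⟨a, (isLUB_iff_of_subset_of_subset_closure subset_closure le_rfl).2 ha⟩

variable {K L : Type u} [LinearOrder K] [LinearOrder L]

theorem exists_isLUB_lex (hK : ∀ s : Set K, ∃ a, IsLUB s a) (hL : ∀ s : Set L, ∃ a, IsLUB s a)
    (s : Set (K ×ₗ L)) : ∃ a, IsLUB s a := by
  obtain ⟨a, ha⟩ := hK ((fun x => (ofLex x).1) '' s)
  -- If `a` is not attained, this set is empty and `b` is the minimum of `L`, as needed.
  obtain ⟨b, hb⟩ := hL {l | toLex (a, l) ∈ s}
  refine ⟨toLex (a, b), fun x hx => ?_, fun y hy => ?_⟩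
  · rcases (ha.1 ⟨x, hx, rfl⟩).lt_or_eq with h | h
    · exact Prod.Lex.le_iff.2 (Or.inl h)
    · refine Prod.Lex.le_iff.2 (Or.inr ⟨h, hb.1 ?_⟩)
      rw [Set.mem_ofPred_eq, ← h]
      exact hx
  · have h1 : a ≤ (ofLex y).1 := ha.2 <| by
      rintro _ ⟨x, hx, rfl⟩
      exact Prod.Lex.monotone_fst x y (hy hx)
    rcases h1.lt_or_eq with h | h
    · exact Prod.Lex.le_iff.2 (Or.inl h)
    · refine Prod.Lex.le_iff.2 (Or.inr ⟨h, hb.2 fun l hl => ?_⟩)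
      rcases Prod.Lex.le_iff.1 (hy hl) with h2 | h2
      · exact absurd h h2.ne
      · exact h2.2

theorem isCompactLine_lex [TopologicalSpace K] [TopologicalSpace L] [TopologicalSpace (K ×ₗ L)]
    [OrderTopology (K ×ₗ L)] (hK : IsCompactLine K) (hL : IsCompactLine L) :
    IsCompactLine (K ×ₗ L) := by
  refine ⟨inferInstance, ?_⟩
  have := hK.orderTopology
  have := hK.compactSpace
  have := hL.orderTopology
  have := hL.compactSpace
  rcases isEmpty_or_nonempty (K ×ₗ L) with h | ⟨⟨x⟩⟩
  · infer_instance
  · have : Nonempty K := ⟨(ofLex x).1⟩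
    have : Nonempty L := ⟨(ofLex x).2⟩
    exact compactSpace_of_exists_isLUB
      (exists_isLUB_lex exists_isLUB_of_compactSpace exists_isLUB_of_compactSpace)

/-- The fibres of the first projection of a lexicographic product. -/
def lexFiberIso (t : K) : L ≃o ((fun x : K ×ₗ L => (ofLex x).1) ⁻¹' {t} : Set (K ×ₗ L)) where
  toFun l := ⟨toLex (t, l), rfl⟩
  invFun x := (ofLex x.1).2
  left_inv _ := rfl
  right_inv x := Subtype.ext (congrArg toLex (Prod.ext (Eq.symm x.2) rfl))
  map_rel_iff' {a b} := (Prod.Lex.toLex_le_toLex (x := (t, a)) (y := (t, b))).trans (by simp)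

/-- The preimages of the open rays at `t` are the open rays beyond the extremes of the fibre over
`t`. -/
theorem continuous_of_fibers_bounded {X Y : Type*} [LinearOrder X] [TopologicalSpace X]
    [OrderTopology X] [LinearOrder Y] [TopologicalSpace Y] [OrderTopology Y] {φ : X → Y}
    (hmono : Monotone φ) (h : ∀ t, ∃ a b, IsLeast (φ ⁻¹' {t}) a ∧ IsGreatest (φ ⁻¹' {t}) b) :
    Continuous φ := by
  refine OrderTopology.continuous_iff.2 fun t => ?_
  obtain ⟨a, b, ha, hb⟩ := h t
  have haφ : φ a = t := ha.1
  have hbφ : φ b = t := hb.1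
  have h1 : φ ⁻¹' Set.Ioi t = Set.Ioi b := by
    ext x
    refine ⟨fun (hx : t < φ x) => ?_, fun (hx : b < x) => ?_⟩
    · by_contra! hle
      exact hx.not_ge ((hmono (not_lt.1 hle)).trans_eq hbφ)
    · by_contra! hle
      exact hx.not_ge (hb.2 (le_antisymm (not_lt.1 hle) (hbφ.symm.trans_le (hmono hx.le))))
  have h2 : φ ⁻¹' Set.Iio t = Set.Iio a := by
    ext x
    refine ⟨fun (hx : φ x < t) => ?_, fun (hx : x < a) => ?_⟩
    · by_contra! hle
      exact hx.not_ge (haφ.symm.trans_le (hmono (not_lt.1 hle)))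
    · by_contra! hle
      exact hx.not_ge (ha.2 (le_antisymm ((hmono hx.le).trans_eq haφ) (not_lt.1 hle)))
  exact ⟨h1 ▸ isOpen_Ioi, h2 ▸ isOpen_Iio⟩

theorem IsSeparablyDetermined.lex [TopologicalSpace K] [TopologicalSpace L]
    [TopologicalSpace (K ×ₗ L)] [OrderTopology (K ×ₗ L)] (hK : IsSeparablyDetermined K)
    (hL : IsSeparablyDetermined L) : IsSeparablyDetermined (K ×ₗ L) := by
  have hKL := isCompactLine_lex hK.isCompactLine hL.isCompactLine
  have := hKL.compactSpace
  have := hK.isCompactLine.orderTopology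
  rcases isEmpty_or_nonempty (K ×ₗ L) with h | ⟨⟨x⟩⟩
  · exact .of_isEmpty hKL
  have hmono : Monotone fun x : K ×ₗ L => (ofLex x).1 := Prod.Lex.monotone_fst
  have hsurj : Function.Surjective fun x : K ×ₗ L => (ofLex x).1 := fun t =>
    ⟨toLex (t, (ofLex x).2), rfl⟩
  have := hL.isCompactLine.orderTopology
  have := hL.isCompactLine.compactSpace
  have hne : (Set.univ : Set L).Nonempty := ⟨(ofLex x).2, trivial⟩
  obtain ⟨a, ha⟩ := isCompact_univ.exists_isLeast hne
  obtain ⟨b, hb⟩ := isCompact_univ.exists_isGreatest hne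
  have hcont : Continuous fun x : K ×ₗ L => (ofLex x).1 :=
    continuous_of_fibers_bounded hmono fun t => ⟨toLex (t, a), toLex (t, b),
      ⟨rfl, fun y hy => Prod.Lex.le_iff.2 (Or.inr ⟨Eq.symm hy, ha.2 trivial⟩)⟩,
      ⟨rfl, fun y hy => Prod.Lex.le_iff.2 (Or.inr ⟨hy, hb.2 trivial⟩)⟩⟩
  refine .of_fibers hKL hcont hmono hsurj hK fun t => hL.of_orderIso ?_ (lexFiberIso t)
  have hconn := Set.ordConnected_singleton (a := t).preimage_mono hmono
  exact ⟨inferInstance, isCompact_iff_compactSpace.1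
    (isClosed_singleton.preimage hcont).isCompact⟩

end Lex

theorem theorem3p10 :
    (∀ (K L : Type u) [LinearOrder K] [TopologicalSpace K] [LinearOrder L] [TopologicalSpace L],
      IsCompactLine K → IsCompactLine L →
      ∀ φ : K → L, Continuous φ → Monotone φ → Function.Surjective φ →
        IsSeparablyDetermined L →
        (∀ t : L, IsSeparablyDetermined (φ ⁻¹' {t})) →
        IsSeparablyDetermined K) ∧
    (∀ (K L : Type u) [LinearOrder K] [TopologicalSpace K] [LinearOrder L] [TopologicalSpace L],
      IsSeparablyDetermined K → IsSeparablyDetermined L →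
        @IsSeparablyDetermined (K ×ₗ L) _ (Preorder.topology (K ×ₗ L))) := by
  refine ⟨fun K L _ _ _ _ hK _ φ hφ hmono hsurj hL hfib => .of_fibers hK hφ hmono hsurj hL hfib,
    fun K L _ _ _ _ hK hL => ?_⟩
  let _ : TopologicalSpace (K ×ₗ L) := Preorder.topology (K ×ₗ L)
  have : OrderTopology (K ×ₗ L) := ⟨rfl⟩
  exact hK.lex hL
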